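/- Let $N\ge 2$, let $\Omega\subset\mathbb{R}^N$ be a bounded Lipschitz domain, and let $0<s<1<p<N/s$. For measurable $u:\mathbb{R}^N\to\mathbb{R}$ put $$[u]_{s,p}=\Big(\int_{\mathbb{R}^N}\int_{\mathbb{R}^N}\frac{|u(x)-u(y)|^p}{|x-y|^{N+sp}}\,dx\,dy\Big)^{1/p},$$ write $|u|_q$ for the $L^q$ norm ($1\le q\le\infty$), and let $W_0^{s,p}(\Omega)$ be the closure of $C_0^\infty(\Omega)$ (functions extended by zero to $\mathbb{R}^N$) with respect to the norm $[u]_{s,p}+|u|_p$. A function $u\in W_0^{s,p}(\Omega)$ is a weak solution of $(-\Delta)_p^s u=f$ in $\Omega$, $u=0$ in $\mathbb{R}^N\setminus\Omega$, if for all $\varphi\in W_0^{s,p}(\Omega)$ $$\int_{\mathbb{R}^N}\int_{\mathbb{R}^N}\frac{|u(x)-u(y)|^{p-2}(u(x)-u(y))(\varphi(x)-\varphi(y))}{|x-y|^{N+sp}}\,dx\,dy=\int_\Omega f\varphi\,dx .$$ Let $\lambda_{1,p}^s(\Omega)=\inf\{[u]_{s,p}^p : u\in W_0^{s,p}(\Omega),\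 |u|_p=1\}$ be the first eigenvalue. Let $\phi_p^s$ be the $(s,p)$-torsion function of $\Omega$, i.e. the weak solution for $f\equiv 1$, and let $e_p^s$ be the normalized first eigenfunction, i.e. the weak solution for $f=\lambda_{1,p}^s(\Omega)(e_p^s)^{p-1}$ with $e_p^s>0$ a.e. in $\Omega$ and $|e_p^s|_\infty=1$. Then $$e_p^s\le \lambda_{1,p}^s(\Omega)^{\frac1{p-1}}\,\phi_p^s\quad\text{a.e. in }\Omega,$$ $$\frac{1}{|\phi_p^s|_\infty^{p-1}}\le\lambda_{1,p}^s(\Omega)\le\frac{|\Omega|^{p-1}}{|\phi_p^s|_1^{p-1}},$$ and $\phi_p^s>0$ a.e. in $\Omega$. -/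

import Mathlib

open MeasureTheory Filter Topology
open scoped ContDiff

noncomputable section

namespace FracTorsion

/-- Euclidean space `ℝ^N`. -/
abbrev E (N : ℕ) : Type := EuclideanSpace ℝ (Fin N)

/-- A bounded Lipschitz domain: a nonempty, open, connected, bounded set which, near each boundary
point, is the strict epigraph of a Lipschitz function in some orthogonal coordinate system.
Here `ν` is the unit vector of the vertical axis, `inner ℝ ν x` is the height of `x`, and
`x - inner ℝ ν x • ν` is the projection of `x` to the hyperplane orthogonal to `ν`. -/
structure IsBoundedLipschitzDomain {N : ℕ} (Ω : Set (E N)) : Prop where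
  isOpen : IsOpen Ω
  isConnected : IsConnected Ω
  isBounded : Bornology.IsBounded Ω
  lipschitz_boundary : ∀ x₀ ∈ frontier Ω, ∃ ν : E N, ‖ν‖ = 1 ∧ ∃ (K : NNReal) (g : E N → ℝ),
    LipschitzWith K g ∧
      ∀ᶠ x in 𝓝 x₀, x ∈ Ω ↔ g (x - inner ℝ ν x • ν) < inner ℝ ν x

/-- The `p`-th power `[u]_{s,p}^p` of the Gagliardo seminorm on `ℝ^N`, with values in `[0, ∞]`. -/
def gagliardoPow {N : ℕ} (s p : ℝ) (u : E N → ℝ) : ENNReal :=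
  ∫⁻ z : E N × E N,
    ENNReal.ofReal (|u z.1 - u z.2| ^ p / ‖z.1 - z.2‖ ^ ((N : ℝ) + s * p))
      ∂((volume : Measure (E N)).prod volume)

/-- The Gagliardo seminorm `[u]_{s,p}` on `ℝ^N`. -/
def gagliardo {N : ℕ} (s p : ℝ) (u : E N → ℝ) : ENNReal :=
  gagliardoPow s p u ^ (1 / p)

/-- The norm `[u]_{s,p} + |u|_p`. -/
def sobolevNorm {N : ℕ} (s p : ℝ) (u : E N → ℝ) : ENNReal :=
  gagliardo s p u + eLpNorm u (ENNReal.ofReal p) volume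

/-- `C_0^∞(Ω)`: smooth functions with compact support contained in `Ω`. -/
structure IsTestFunction {N : ℕ} (Ω : Set (E N)) (ψ : E N → ℝ) : Prop where
  contDiff : ContDiff ℝ ∞ ψ
  hasCompactSupport : HasCompactSupport ψ
  tsupport_subset : tsupport ψ ⊆ Ω

/-- `u ∈ W_0^{s,p}(Ω)`: the (measurable) function `u` on `ℝ^N` is in the closure of `C_0^∞(Ω)`
with respect to the norm `[·]_{s,p} + |·|_p`. -/
structure MemW0 {N : ℕ} (s p : ℝ) (Ω : Set (E N)) (u : E N → ℝ) : Prop where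
  aestronglyMeasurable : AEStronglyMeasurable u volume
  mem_closure : ∀ ε : ENNReal, 0 < ε →
    ∃ ψ : E N → ℝ, IsTestFunction Ω ψ ∧ sobolevNorm s p (fun x => u x - ψ x) < ε

/-- The pairing `⟨(-Δ)_p^s u, φ⟩`. -/
def fracPairing {N : ℕ} (s p : ℝ) (u φ : E N → ℝ) : ℝ :=
  ∫ z : E N × E N,
    |u z.1 - u z.2| ^ (p - 2) * (u z.1 - u z.2) * (φ z.1 - φ z.2)
      / ‖z.1 - z.2‖ ^ ((N : ℝ) + s * p)
      ∂((volume : Measure (E N)).prod volume)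

/-- `u` is a weak solution of `(-Δ)_p^s u = f` in `Ω`, `u = 0` in `ℝ^N ∖ Ω`. -/
structure IsWeakSolution {N : ℕ} (s p : ℝ) (Ω : Set (E N)) (f u : E N → ℝ) : Prop where
  memW0 : MemW0 s p Ω u
  weak : ∀ φ : E N → ℝ, MemW0 s p Ω φ → fracPairing s p u φ = ∫ x in Ω, f x * φ x

/-- `φ` is the `(s,p)`-torsion function of `Ω`. -/
def IsTorsionFunction {N : ℕ} (s p : ℝ) (Ω : Set (E N)) (φ : E N → ℝ) : Prop :=
  IsWeakSolution s p Ω (fun _ => 1) φ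

/-- The first eigenvalue `λ_{1,p}^s(Ω)`, through its variational definition. -/
def firstEigenvalue {N : ℕ} (s p : ℝ) (Ω : Set (E N)) : ENNReal :=
  sInf {a | ∃ u : E N → ℝ, MemW0 s p Ω u ∧
    eLpNorm u (ENNReal.ofReal p) (volume.restrict Ω) = 1 ∧ a = gagliardoPow s p u}

/-- `e` is the positive first eigenfunction of `Ω`, normalized by `|e|_∞ = 1`. -/
structure IsNormalizedFirstEigenfunction {N : ℕ} (s p : ℝ) (Ω : Set (E N)) (e : E N → ℝ) :
    Prop where
  isWeakSolution :
    IsWeakSolution s p Ω (fun x => (firstEigenvalue s p Ω).toReal * e x ^ (p - 1)) e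
  pos : ∀ᵐ x ∂(volume.restrict Ω), 0 < e x
  norm_eq_one : eLpNorm e ⊤ (volume.restrict Ω) = 1

end FracTorsion

end

noncomputable section

namespace FracTorsion

/-! ### Difference quotients, the energy and the pairing -/

variable {N : ℕ} {s p : ℝ} {Ω : Set (E N)} {u v w ψ φ e : E N → ℝ}

/-! Two inequalities carry the theorem.

Comparison (`ae_le_of_fracPairing_le`): testing two functions with `w = (u - v)⁺` and using
monotonicity of `t ↦ |t|^(p-2) t`, the difference of the pairings has a nonnegative integrand. If
the integral is at most zero, `w` is a.e. constant, hence zero, since it lies in `L^p` of the whole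
space. As `λ e^(p-1) ≤ λ`, and `λ` is the right-hand side solved by `λ^(1/(p-1)) φ`, the pointwise
bound follows.

Picone (`picone`): testing the torsion equation with `|u|^p / φ^(p-1)` gives formally `∫_Ω |u|^p /
φ^(p-1) ≤ [u]^p` for every `u` in `W_0^{s,p}`. Bounding `φ` by its supremum yields the lower bound
on `λ`; taking `u` a test function, the finite right side forbids `φ` to vanish where `u` does not,
which yields positivity. The upper bound on `λ` is the Rayleigh quotient of `φ`, with `[φ]^p =
|φ|_1` and Hölder.

Since `W_0^{s,p}` is a closure, admissibility of these test functions needs proof: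
`MemW0.comp_lipschitz` covers the positive part and a truncated, regularised Picone quotient. -/

/-- The Hölder quotient `(u(x) - u(y)) / |x - y|^{(N+sp)/p}`, whose `L^p` norm on `ℝ^N × ℝ^N` is
the Gagliardo seminorm. -/
def hquot (s p : ℝ) (u : E N → ℝ) (z : E N × E N) : ℝ :=
  (u z.1 - u z.2) / ‖z.1 - z.2‖ ^ (((N : ℝ) + s * p) / p)

lemma rpow_kernel (hp : 0 < p) (z : E N × E N) :
    (‖z.1 - z.2‖ ^ (((N : ℝ) + s * p) / p)) ^ p = ‖z.1 - z.2‖ ^ ((N : ℝ) + s * p) := by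
  rw [← Real.rpow_mul (norm_nonneg _), div_mul_cancel₀ _ hp.ne']

lemma abs_hquot_rpow (hp : 0 < p) (u : E N → ℝ) (z : E N × E N) :
    |hquot s p u z| ^ p = |u z.1 - u z.2| ^ p / ‖z.1 - z.2‖ ^ ((N : ℝ) + s * p) := by
  have h : (0 : ℝ) ≤ ‖z.1 - z.2‖ ^ (((N : ℝ) + s * p) / p) := by positivity
  rw [hquot, abs_div, abs_of_nonneg h, Real.div_rpow (abs_nonneg _) h, rpow_kernel hp]

lemma gagliardoPow_eq_lintegral (hp : 0 < p) (u : E N → ℝ) :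
    gagliardoPow s p u =
      ∫⁻ z, ENNReal.ofReal (|hquot s p u z| ^ p) ∂((volume : Measure (E N)).prod volume) := by
  simp only [gagliardoPow, abs_hquot_rpow hp]

lemma gagliardo_eq_eLpNorm (hp : 0 < p) (u : E N → ℝ) :
    gagliardo s p u =
      eLpNorm (hquot s p u) (ENNReal.ofReal p) ((volume : Measure (E N)).prod volume) := by
  rw [eLpNorm_eq_lintegral_rpow_enorm_toReal (by simpa using hp) (by simp),
    ENNReal.toReal_ofReal hp.le, gagliardo, gagliardoPow_eq_lintegral hp]
  congr 1
  refine lintegral_congr fun z => ?_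
  rw [← Real.norm_eq_abs, ← ofReal_norm,
    ENNReal.ofReal_rpow_of_nonneg (norm_nonneg _) hp.le]

lemma gagliardoPow_eq_gagliardo_rpow (hp : 0 < p) (u : E N → ℝ) :
    gagliardoPow s p u = gagliardo s p u ^ p := by
  rw [gagliardo, ← ENNReal.rpow_mul, one_div_mul_cancel hp.ne', ENNReal.rpow_one]

/-- The integrand of the pairing in terms of difference quotients. -/
def pairingIntegrand (s p : ℝ) (u v : E N → ℝ) (z : E N × E N) : ℝ :=
  |hquot s p u z| ^ (p - 2) * hquot s p u z * hquot s p v z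

lemma pairingIntegrand_eq (hp : 0 < p) (u v : E N → ℝ) (z : E N × E N) :
    pairingIntegrand s p u v z = |u z.1 - u z.2| ^ (p - 2) * (u z.1 - u z.2) * (v z.1 - v z.2)
      / ‖z.1 - z.2‖ ^ ((N : ℝ) + s * p) := by
  have hk := rpow_kernel (s := s) hp z
  rw [pairingIntegrand, hquot, hquot]
  rcases eq_or_ne z.1 z.2 with h | h
  · simp [h]
  · have h0 : 0 < ‖z.1 - z.2‖ := norm_pos_iff.2 (sub_ne_zero.2 h)
    have hr : (0 : ℝ) < ‖z.1 - z.2‖ ^ (((N : ℝ) + s * p) / p) := by positivity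
    rw [← hk]
    set r := ‖z.1 - z.2‖ ^ (((N : ℝ) + s * p) / p)
    have : r ^ p = r ^ (p - 2) * r ^ 2 := by
      rw [← Real.rpow_natCast r 2, ← Real.rpow_add hr]; norm_num
    rw [this, abs_div, abs_of_pos hr, Real.div_rpow (abs_nonneg _) hr.le]
    have : 0 < r ^ (p - 2) := by positivity
    field_simp

lemma fracPairing_eq (hp : 0 < p) (u v : E N → ℝ) :
    fracPairing s p u v =
      ∫ z, pairingIntegrand s p u v z ∂((volume : Measure (E N)).prod volume) := by
  simp only [fracPairing, pairingIntegrand_eq hp]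

lemma measurable_kernel : Measurable fun z : E N × E N =>
    ‖z.1 - z.2‖ ^ (((N : ℝ) + s * p) / p) := by
  fun_prop

lemma aestronglyMeasurable_hquot (hu : AEStronglyMeasurable u volume) :
    AEStronglyMeasurable (hquot s p u) ((volume : Measure (E N)).prod volume) := by
  have h1 : AEStronglyMeasurable (fun z : E N × E N => u z.1) (volume.prod volume) := hu.comp_fst
  have h2 : AEStronglyMeasurable (fun z : E N × E N => u z.2) (volume.prod volume) := hu.comp_snd
  exact ((h1.sub h2).aemeasurable.div measurable_kernel.aemeasurable).aestronglyMeasurable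

lemma hquot_sub (u v : E N → ℝ) :
    hquot s p (fun x => u x - v x) = hquot s p u - hquot s p v := by
  ext z; simp only [hquot, Pi.sub_apply]; ring

lemma hquot_const_mul (c : ℝ) (u : E N → ℝ) :
    hquot s p (fun x => c * u x) = fun z => c * hquot s p u z := by
  ext z; simp only [hquot]; ring

/-- The larger of `|a|`, `|b|` absorbs the other; this crude Young inequality suffices for
integrability. -/
lemma abs_pow_mul_le (hp : 1 < p) (a b : ℝ) :
    |(|a| ^ (p - 2) * a * b)| ≤ |a| ^ p + |b| ^ p := by
  have hab : |(|a| ^ (p - 2) * a * b)| = |a| ^ (p - 1) * |b| := by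
    rw [abs_mul, abs_mul, abs_of_nonneg (by positivity : 0 ≤ |a| ^ (p - 2))]
    congr 1
    rcases eq_or_ne a 0 with rfl | h
    · simp [Real.zero_rpow (by linarith : p - 1 ≠ 0)]
    · rw [← Real.rpow_add_one (abs_ne_zero.2 h)]; ring_nf
  rw [hab]
  have key : ∀ t : ℝ, 0 ≤ t → t ^ (p - 1) * t = t ^ p := fun t ht => by
    rw [← Real.rpow_add_one' ht (by linarith)]; ring_nf
  have ha := abs_nonneg a
  have hb := abs_nonneg b
  have := Real.rpow_nonneg ha p
  have := Real.rpow_nonneg hb p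
  rcases le_total |a| |b| with h | h
  · calc |a| ^ (p - 1) * |b| ≤ |b| ^ (p - 1) * |b| := by
          gcongr
      _ ≤ _ := by rw [key _ hb]; linarith
  · calc |a| ^ (p - 1) * |b| ≤ |a| ^ (p - 1) * |a| := by gcongr
      _ ≤ _ := by rw [key _ ha]; linarith

lemma integrable_abs_rpow {α : Type*} [MeasurableSpace α] {μ : Measure α} {f : α → ℝ}
    (hp : 0 < p) (hf : MemLp f (ENNReal.ofReal p) μ) : Integrable (fun x => |f x| ^ p) μ := by
  have := hf.integrable_norm_rpow (by simpa using hp) (by simp)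
  simpa [ENNReal.toReal_ofReal hp.le] using this

lemma integrable_pairingIntegrand (hp : 1 < p)
    (hu : MemLp (hquot s p u) (ENNReal.ofReal p) ((volume : Measure (E N)).prod volume))
    (hv : MemLp (hquot s p v) (ENNReal.ofReal p) ((volume : Measure (E N)).prod volume)) :
    Integrable (pairingIntegrand s p u v) ((volume : Measure (E N)).prod volume) := by
  have hp0 : 0 < p := by linarith
  refine Integrable.mono' ((integrable_abs_rpow hp0 hu).add (integrable_abs_rpow hp0 hv)) ?_
    (.of_forall fun z => ?_)
  · have h1 := hu.1.aemeasurable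
    have h2 := hv.1.aemeasurable
    refine AEMeasurable.aestronglyMeasurable ?_
    exact ((h1.abs.pow_const (p - 2)).mul h1).mul h2
  · simpa [pairingIntegrand] using abs_pow_mul_le hp (hquot s p u z) (hquot s p v z)

/-! ### Smooth functions with compact support have finite seminorm -/

/-- Near the origin the integrand is at most `L^p ‖h‖^(p - N - sp)`, integrable because `s < 1`; far
away it is at most `M^p ‖h‖^(-N - sp)`, integrable because `sp > 0`. -/
lemma lintegral_truncated_kernel_lt_top (hN : 1 ≤ N) (hs0 : 0 < s) (hs1 : s < 1) (hp : 1 < p)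
    {L M : ℝ} (hL : 0 ≤ L) (hM : 0 ≤ M) :
    ∫⁻ h : E N, ENNReal.ofReal (min (L * ‖h‖) M ^ p / ‖h‖ ^ ((N : ℝ) + s * p)) < ⊤ := by
  have hp0 : 0 < p := by linarith
  have hsp : 0 < s * p := by positivity
  have hfin : Module.finrank ℝ (E N) = N := by simp
  set G : E N → ℝ := fun h => min (L * ‖h‖) M ^ p / ‖h‖ ^ ((N : ℝ) + s * p) with hG
  have hG0 : ∀ h, 0 ≤ G h := fun h => by
    have : 0 ≤ min (L * ‖h‖) M := le_min (by positivity) hM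
    positivity
  have hGm : Measurable G := by fun_prop
  have h1 : IntegrableOn G (Metric.ball 0 1) := by
    refine integrableOn_ball_of_norm_le_rpow (C := L ^ p) (α := -(p - (N + s * p))) (by omega) ?_ ?_
      hGm.aestronglyMeasurable
    · rw [hfin]; nlinarith
    · refine .of_forall fun h => ?_
      rw [Real.norm_of_nonneg (hG0 h), neg_neg]
      rcases eq_or_ne h 0 with rfl | h0
      · simp only [hG, norm_zero, mul_zero, min_eq_left hM, Real.zero_rpow hp0.ne', zero_div]
        positivity
      · have h0 : 0 < ‖h‖ := norm_pos_iff.2 h0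
        rw [Real.rpow_sub h0, ← mul_div_assoc, ← Real.mul_rpow hL h0.le]
        simp only [hG]
        gcongr
        exact min_le_left _ _
  have h2 : IntegrableOn G (Metric.ball 0 1)ᶜ := by
    -- The factor `2^(N + sp)` comes from `1 + ‖h‖ ≤ 2‖h‖` outside the unit ball.
    have := (integrable_one_add_norm (E := E N) (μ := volume) (r := (N : ℝ) + s * p)
      (by rw [hfin]; linarith)).const_mul (M ^ p * 2 ^ ((N : ℝ) + s * p))
    refine Integrable.mono' this.integrableOn hGm.aestronglyMeasurable ?_
    refine (ae_restrict_iff' Metric.isOpen_ball.measurableSet.compl).2 (.of_forall fun h hh => ?_)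
    have hh : 1 ≤ ‖h‖ := by simpa using hh
    rw [Real.norm_of_nonneg (hG0 h), Real.rpow_neg (by positivity), ← div_eq_mul_inv,
      mul_div_assoc, ← Real.div_rpow (by positivity) (by positivity)]
    have h3 : (2 / (1 + ‖h‖)) ^ ((N : ℝ) + s * p) ≥ (1 / ‖h‖) ^ ((N : ℝ) + s * p) := by
      gcongr ?_ ^ _
      rw [div_le_div_iff₀ (by positivity) (by positivity)]; linarith
    rw [Real.div_rpow zero_le_one (by positivity), Real.one_rpow] at h3
    have : min (L * ‖h‖) M ^ p ≤ M ^ p := by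
      gcongr
      exact min_le_right _ _
    calc G h = min (L * ‖h‖) M ^ p * (1 / ‖h‖ ^ ((N : ℝ) + s * p)) := by simp only [hG]; ring
      _ ≤ _ := by gcongr
  have : Integrable G := by
    rw [← integrableOn_univ, ← Set.union_compl_self (Metric.ball 0 1)]
    exact h1.union h2
  exact (hasFiniteIntegral_iff_ofReal (.of_forall hG0)).1 this.2

lemma IsTestFunction.exists_bound (hψ : IsTestFunction Ω ψ) :
    ∃ L M : ℝ, 0 ≤ L ∧ 0 ≤ M ∧ (∀ x, |ψ x| ≤ M) ∧ ∀ x y, |ψ x - ψ y| ≤ min (L * ‖x - y‖) M := by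
  obtain ⟨K, hK⟩ := (hψ.contDiff.of_le (by simp)).lipschitzWith_of_hasCompactSupport
    hψ.hasCompactSupport one_ne_zero
  obtain ⟨C, hC⟩ := hψ.hasCompactSupport.exists_bound_of_continuous hψ.contDiff.continuous
  have hC0 : 0 ≤ C := (norm_nonneg _).trans (hC 0)
  refine ⟨K, 2 * C, K.2, by linarith, fun x => ?_, fun x y => le_min ?_ ?_⟩
  · have := hC x; rw [Real.norm_eq_abs] at this; linarith
  · simpa [Real.dist_eq, dist_eq_norm] using hK.dist_le_mul x y
  · have := hC x; have := hC y; rw [Real.norm_eq_abs] at *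
    linarith [abs_sub (ψ x) (ψ y)]

/-- The integrand vanishes unless one of the two points lies in the compact support; Tonelli and
translation invariance then reduce to the truncated kernel. -/
lemma IsTestFunction.gagliardoPow_lt_top (hN : 1 ≤ N) (hs0 : 0 < s) (hs1 : s < 1) (hp : 1 < p)
    (hψ : IsTestFunction Ω ψ) : gagliardoPow s p ψ < ⊤ := by
  have hp0 : 0 < p := by linarith
  obtain ⟨L, M, hL, hM, -, hLM⟩ := hψ.exists_bound
  set G : E N → ENNReal := fun h =>
    ENNReal.ofReal (min (L * ‖h‖) M ^ p / ‖h‖ ^ ((N : ℝ) + s * p)) with hG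
  have hGm : Measurable G := by fun_prop
  have hI : ∫⁻ h, G h < ⊤ := lintegral_truncated_kernel_lt_top hN hs0 hs1 hp hL hM
  set K := tsupport ψ
  have hKm : MeasurableSet K := (isClosed_tsupport _).measurableSet
  have hKfin : volume K < ⊤ := hψ.hasCompactSupport.isCompact.measure_lt_top
  have key : ∀ z : E N × E N,
      ENNReal.ofReal (|ψ z.1 - ψ z.2| ^ p / ‖z.1 - z.2‖ ^ ((N : ℝ) + s * p)) ≤
        K.indicator 1 z.1 * G (z.1 - z.2) + K.indicator 1 z.2 * G (z.1 - z.2) := by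
    intro z
    have hle : ENNReal.ofReal (|ψ z.1 - ψ z.2| ^ p / ‖z.1 - z.2‖ ^ ((N : ℝ) + s * p)) ≤
        G (z.1 - z.2) := by
      apply ENNReal.ofReal_le_ofReal
      gcongr
      exact hLM _ _
    by_cases h1 : z.1 ∈ K
    · refine le_trans hle ?_
      simp [h1]
    by_cases h2 : z.2 ∈ K
    · refine le_trans hle ?_
      simp [h2]
    · simp [image_eq_zero_of_notMem_tsupport h1, image_eq_zero_of_notMem_tsupport h2,
        Real.zero_rpow hp0.ne']
  have hm1 : Measurable fun z : E N × E N => K.indicator (1 : E N → ENNReal) z.1 * G (z.1 - z.2) :=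
    ((measurable_one.indicator hKm).comp measurable_fst).mul
      (hGm.comp (measurable_fst.sub measurable_snd))
  have hm2 : Measurable fun z : E N × E N => K.indicator (1 : E N → ENNReal) z.2 * G (z.1 - z.2) :=
    ((measurable_one.indicator hKm).comp measurable_snd).mul
      (hGm.comp (measurable_fst.sub measurable_snd))
  have hK1 : ∫⁻ x, K.indicator (1 : E N → ENNReal) x * ∫⁻ h, G h = volume K * ∫⁻ h, G h := by
    rw [lintegral_mul_const _ (measurable_one.indicator hKm), lintegral_indicator_one hKm]
  refine (lintegral_mono key).trans_lt ?_
  rw [lintegral_add_left hm1, ENNReal.add_lt_top]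
  have hfin : volume K * ∫⁻ h, G h < ⊤ := ENNReal.mul_lt_top hKfin hI
  constructor
  · rw [lintegral_prod _ hm1.aemeasurable]
    have : ∀ x : E N, ∫⁻ y, K.indicator (1 : E N → ENNReal) x * G (x - y) =
        K.indicator (1 : E N → ENNReal) x * ∫⁻ h, G h := fun x => by
      rw [lintegral_const_mul _ (by fun_prop), lintegral_sub_left_eq_self G x]
    simp only [this]
    rwa [hK1]
  · rw [lintegral_prod_symm _ hm2.aemeasurable]
    have : ∀ y : E N, ∫⁻ x, K.indicator (1 : E N → ENNReal) y * G (x - y) =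
        K.indicator (1 : E N → ENNReal) y * ∫⁻ h, G h := fun y => by
      rw [lintegral_const_mul _ (by fun_prop), lintegral_sub_right_eq_self G y]
    simp only [this]
    rwa [hK1]

/-! ### Convergence in `L^p` under convergent majorants -/

/-- Vitali's theorem: the `g n` converge in `L^q`, so they are uniformly integrable and tight, and
the `f n` inherit both. -/
lemma tendsto_eLpNorm_of_dominated {α : Type*} [MeasurableSpace α] {μ : Measure α}
    {q : ENNReal} (hq1 : 1 ≤ q) (hq : q ≠ ⊤) {f g : ℕ → α → ℝ} {F G : α → ℝ}
    (hf : ∀ n, AEStronglyMeasurable (f n) μ) (hF : MemLp F q μ)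
    (hg : ∀ n, MemLp (g n) q μ) (hG : MemLp G q μ)
    (hfg : ∀ n x, |f n x| ≤ |g n x|)
    (hlim : ∀ᵐ x ∂μ, Tendsto (fun n => f n x) atTop (𝓝 (F x)))
    (hgG : Tendsto (fun n => eLpNorm (g n - G) q μ) atTop (𝓝 0)) :
    Tendsto (fun n => eLpNorm (f n - F) q μ) atTop (𝓝 0) := by
  obtain ⟨-, hui, hut⟩ := (tendstoInMeasure_iff_tendsto_Lp hq1 hq hg hG).2 hgG
  have hle : ∀ (t : Set α) n, eLpNorm (t.indicator (f n)) q μ ≤ eLpNorm (t.indicator (g n)) q μ := by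
    intro t n
    refine eLpNorm_mono fun x => ?_
    by_cases hx : x ∈ t
    · simpa [hx] using hfg n x
    · simp [hx]
  refine tendsto_Lp_of_tendsto_ae hq1 hq hf hF ?_ ?_ hlim
  · intro ε hε
    obtain ⟨δ, hδ, h⟩ := hui hε
    exact ⟨δ, hδ, fun i t ht hμ => (hle t i).trans (h i t ht hμ)⟩
  · intro ε hε
    obtain ⟨t, ht, h⟩ := hut hε
    exact ⟨t, ht, fun i => (hle _ i).trans (h i)⟩

/-! ### Smooth approximation of Lipschitz functions -/

open scoped Convolution in
-- Mollification keeps the Lipschitz constant. Subtracting the value at `0` restores `H 0 = 0` at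
-- the price of a second error `ε / 2`.
lemma exists_smooth_lipschitz_approx {V : Type*} [NormedAddCommGroup V] [NormedSpace ℝ V]
    [FiniteDimensional ℝ V] [MeasurableSpace V] [BorelSpace V] {K : NNReal} {F : V → ℝ}
    (hF : LipschitzWith K F) (hF0 : F 0 = 0) {ε : ℝ} (hε : 0 < ε) :
    ∃ H : V → ℝ, ContDiff ℝ ∞ H ∧ LipschitzWith K H ∧ H 0 = 0 ∧ ∀ x, |H x - F x| ≤ ε := by
  let μ : Measure V := Measure.addHaar
  obtain ⟨δ, hδ, hKδ⟩ : ∃ δ : ℝ, 0 < δ ∧ K * δ ≤ ε / 2 := by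
    refine ⟨ε / 2 / (K + 1), by positivity, ?_⟩
    rw [mul_div_assoc', div_le_iff₀ (by positivity)]
    nlinarith [K.2]
  let η : ContDiffBump (0 : V) := ⟨δ / 2, δ, by positivity, by linarith⟩
  let C : V → ℝ := η.normed μ ⋆[ContinuousLinearMap.lsmul ℝ ℝ, μ] F
  have hC : ∀ x, |C x - F x| ≤ ε / 2 := fun x => by
    have := η.dist_normed_convolution_le (μ := μ) (g := F) (x₀ := x) (ε := ε / 2)
      hF.continuous.aestronglyMeasurable (fun y hy => ?_)
    · rwa [Real.dist_eq] at this
    · refine (hF.dist_le_mul y x).trans (le_trans ?_ hKδ)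
      have : dist y x < δ := hy
      gcongr
  have hint : ∀ x, Integrable (fun t => η.normed μ t * F (x - t)) μ := fun x =>
    (η.continuous_normed.mul (hF.continuous.comp (by fun_prop))).integrable_of_hasCompactSupport
      (η.hasCompactSupport_normed.mul_right)
  have hLip : LipschitzWith K C := by
    refine LipschitzWith.of_dist_le_mul fun x y => ?_
    have hxy : C x - C y = ∫ t, η.normed μ t * (F (x - t) - F (y - t)) ∂μ := by
      simp only [C, convolution_def, ContinuousLinearMap.lsmul_apply, smul_eq_mul]
      rw [← integral_sub (hint x) (hint y)]
      simp only [mul_sub]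
    rw [Real.dist_eq, hxy, ← Real.norm_eq_abs]
    calc ‖∫ t, η.normed μ t * (F (x - t) - F (y - t)) ∂μ‖
        ≤ ∫ t, η.normed μ t * (K * dist x y) ∂μ := by
          refine norm_integral_le_of_norm_le (η.integrable_normed.mul_const _) (.of_forall fun t => ?_)
          rw [norm_mul, Real.norm_of_nonneg (η.nonneg_normed t)]
          refine mul_le_mul_of_nonneg_left ?_ (η.nonneg_normed t)
          simpa [Real.dist_eq] using hF.dist_le_mul (x - t) (y - t)
      _ = K * dist x y := by rw [integral_mul_const, η.integral_normed, one_mul]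
  refine ⟨fun x => C x - C 0, ?_, ?_, by simp, fun x => ?_⟩
  · refine ContDiff.sub ?_ contDiff_const
    exact η.hasCompactSupport_normed.contDiff_convolution_left _ η.contDiff_normed
      hF.continuous.locallyIntegrable
  · exact LipschitzWith.of_dist_le_mul fun x y => by simpa using hLip.dist_le_mul x y
  · have h1 := abs_le.1 (hC x)
    have h2 := abs_le.1 (hC 0)
    rw [hF0] at h2
    exact abs_le.2 ⟨by linarith, by linarith⟩

/-! ### The space `W_0^{s,p}` -/

lemma sobolevNorm_eq (hp : 0 < p) (u : E N → ℝ) :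
    sobolevNorm s p u =
      eLpNorm (hquot s p u) (ENNReal.ofReal p) ((volume : Measure (E N)).prod volume) +
        eLpNorm u (ENNReal.ofReal p) volume := by
  rw [sobolevNorm, gagliardo_eq_eLpNorm hp]

lemma IsTestFunction.memLp (hψ : IsTestFunction Ω ψ) (q : ENNReal) : MemLp ψ q volume :=
  hψ.contDiff.continuous.memLp_of_hasCompactSupport hψ.hasCompactSupport

lemma IsTestFunction.memLp_hquot (hN : 1 ≤ N) (hs0 : 0 < s) (hs1 : s < 1) (hp : 1 < p)
    (hψ : IsTestFunction Ω ψ) :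
    MemLp (hquot s p ψ) (ENNReal.ofReal p) ((volume : Measure (E N)).prod volume) := by
  have hp0 : 0 < p := by linarith
  refine ⟨aestronglyMeasurable_hquot hψ.contDiff.continuous.aestronglyMeasurable, ?_⟩
  rw [← gagliardo_eq_eLpNorm hp0, gagliardo]
  exact ENNReal.rpow_lt_top_of_nonneg (by positivity) (hψ.gagliardoPow_lt_top hN hs0 hs1 hp).ne

lemma IsTestFunction.memW0 (hψ : IsTestFunction Ω ψ) (hp : 0 < p) : MemW0 s p Ω ψ := by
  refine ⟨hψ.contDiff.continuous.aestronglyMeasurable, fun ε hε => ⟨ψ, hψ, ?_⟩⟩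
  rw [sobolevNorm_eq hp, hquot_sub]
  simpa using hε

lemma IsTestFunction.comp {F : ℝ × ℝ → ℝ} (hF : ContDiff ℝ ∞ F) (hF0 : F 0 = 0)
    (hu : IsTestFunction Ω u) (hv : IsTestFunction Ω v) :
    IsTestFunction Ω fun x => F (u x, v x) := by
  have hsub : tsupport (fun x => F (u x, v x)) ⊆ tsupport u ∪ tsupport v := by
    refine closure_minimal (fun x hx => ?_) ((isClosed_tsupport _).union (isClosed_tsupport _))
    by_contra h
    rw [Set.mem_union, not_or] at h
    apply hx
    simp only [image_eq_zero_of_notMem_tsupport h.1, image_eq_zero_of_notMem_tsupport h.2]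
    exact hF0
  refine ⟨hF.comp (hu.contDiff.prodMk hv.contDiff), ?_,
    hsub.trans (Set.union_subset hu.tsupport_subset hv.tsupport_subset)⟩
  exact (hu.hasCompactSupport.isCompact.union hv.hasCompactSupport.isCompact).of_isClosed_subset
    (isClosed_tsupport _) hsub

namespace MemW0

/-- The subsequence is taken for the a.e. convergence, which survives composition with nonlinear
functions. -/
lemma exists_seq (hp : 1 < p) (hu : MemW0 s p Ω u) :
    ∃ ψ : ℕ → E N → ℝ, (∀ n, IsTestFunction Ω (ψ n)) ∧
      Tendsto (fun n => eLpNorm (ψ n - u) (ENNReal.ofReal p) volume) atTop (𝓝 0) ∧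
      Tendsto (fun n => eLpNorm (hquot s p (ψ n) - hquot s p u) (ENNReal.ofReal p)
        ((volume : Measure (E N)).prod volume)) atTop (𝓝 0) ∧
      ∀ᵐ x, Tendsto (fun n => ψ n x) atTop (𝓝 (u x)) := by
  have hp0 : 0 < p := by linarith
  have h := fun n : ℕ => hu.mem_closure ((n : ENNReal) + 1)⁻¹ (by simp)
  choose ψ hψ hlt using h
  have hlim0 : Tendsto (fun n : ℕ => ((n : ENNReal) + 1)⁻¹) atTop (𝓝 0) := by
    have := (tendsto_add_atTop_iff_nat 1).2 ENNReal.tendsto_inv_nat_nhds_zero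
    simpa using this
  have h1 : Tendsto (fun n => eLpNorm (ψ n - u) (ENNReal.ofReal p) volume) atTop (𝓝 0) := by
    refine tendsto_of_tendsto_of_tendsto_of_le_of_le tendsto_const_nhds hlim0
      (fun _ => zero_le) fun n => ?_
    rw [eLpNorm_sub_comm]
    refine le_trans ?_ (hlt n).le
    rw [sobolevNorm_eq hp0]
    exact le_add_self
  have h2 : Tendsto (fun n => eLpNorm (hquot s p (ψ n) - hquot s p u) (ENNReal.ofReal p)
        ((volume : Measure (E N)).prod volume)) atTop (𝓝 0) := by
    refine tendsto_of_tendsto_of_tendsto_of_le_of_le tendsto_const_nhds hlim0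
      (fun _ => zero_le) fun n => ?_
    rw [eLpNorm_sub_comm]
    refine le_trans ?_ (hlt n).le
    rw [sobolevNorm_eq hp0, ← hquot_sub]
    exact le_self_add
  obtain ⟨ns, hns, hae⟩ := (tendstoInMeasure_of_tendsto_eLpNorm (by simpa using hp0)
    (fun n => (hψ n).contDiff.continuous.aestronglyMeasurable) hu.aestronglyMeasurable
    h1).exists_seq_tendsto_ae
  exact ⟨ψ ∘ ns, fun n => hψ _, h1.comp hns.tendsto_atTop, h2.comp hns.tendsto_atTop, hae⟩

lemma memLp (hp : 1 < p) (hu : MemW0 s p Ω u) : MemLp u (ENNReal.ofReal p) volume := by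
  obtain ⟨ψ, hψ, hlt⟩ := hu.mem_closure 1 one_pos
  rw [sobolevNorm_eq (by linarith)] at hlt
  have h : MemLp (fun x => u x - ψ x) (ENNReal.ofReal p) volume :=
    ⟨hu.aestronglyMeasurable.sub hψ.contDiff.continuous.aestronglyMeasurable,
      (le_add_self.trans_lt hlt).trans ENNReal.one_lt_top⟩
  simpa [Pi.add_def] using h.add (hψ.memLp _)

lemma memLp_hquot (hN : 1 ≤ N) (hs0 : 0 < s) (hs1 : s < 1) (hp : 1 < p) (hu : MemW0 s p Ω u) :
    MemLp (hquot s p u) (ENNReal.ofReal p) ((volume : Measure (E N)).prod volume) := by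
  obtain ⟨ψ, hψ, hlt⟩ := hu.mem_closure 1 one_pos
  rw [sobolevNorm_eq (by linarith), hquot_sub] at hlt
  have h : MemLp (hquot s p u - hquot s p ψ) (ENNReal.ofReal p) (volume.prod volume) :=
    ⟨(aestronglyMeasurable_hquot hu.aestronglyMeasurable).sub
      (aestronglyMeasurable_hquot hψ.contDiff.continuous.aestronglyMeasurable),
      (le_self_add.trans_lt hlt).trans ENNReal.one_lt_top⟩
  simpa using h.add (hψ.memLp_hquot hN hs0 hs1 hp)

end MemW0

lemma abs_sub_le_of_lipschitzWith {K : NNReal} {F : ℝ × ℝ → ℝ} (hF : LipschitzWith K F)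
    (a b c d : ℝ) : |F (a, b) - F (c, d)| ≤ K * (|a - c| + |b - d|) := by
  have := hF.dist_le_mul (a, b) (c, d)
  rw [Real.dist_eq, Prod.dist_eq, Real.dist_eq, Real.dist_eq] at this
  refine this.trans ?_
  gcongr
  exact max_le (by linarith [abs_nonneg (b - d)]) (by linarith [abs_nonneg (a - c)])

lemma abs_hquot_comp_le {K : NNReal} {F : ℝ × ℝ → ℝ} (hF : LipschitzWith K F)
    (u v : E N → ℝ) (z : E N × E N) :
    |hquot s p (fun x => F (u x, v x)) z| ≤ K * (|hquot s p u z| + |hquot s p v z|) := by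
  have h : (0 : ℝ) ≤ ‖z.1 - z.2‖ ^ (((N : ℝ) + s * p) / p) := by positivity
  simp only [hquot, abs_div, abs_of_nonneg h]
  rw [← add_div, ← mul_div_assoc]
  gcongr
  exact abs_sub_le_of_lipschitzWith hF _ _ _ _

lemma memLp_majorant {α : Type*} [MeasurableSpace α] {μ : Measure α} {q : ENNReal}
    {f g : α → ℝ} (K : ℝ) (hf : MemLp f q μ) (hg : MemLp g q μ) :
    MemLp (fun x => K * (|f x| + |g x|)) q μ := by
  simpa using (hf.norm.add hg.norm).const_mul K

lemma tendsto_eLpNorm_majorant {α : Type*} [MeasurableSpace α] {μ : Measure α} {q : ENNReal}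
    (hq : 1 ≤ q) (K : ℝ) {f g : ℕ → α → ℝ} {F G : α → ℝ}
    (hfm : ∀ n, AEStronglyMeasurable (f n - F) μ) (hgm : ∀ n, AEStronglyMeasurable (g n - G) μ)
    (hf : Tendsto (fun n => eLpNorm (f n - F) q μ) atTop (𝓝 0))
    (hg : Tendsto (fun n => eLpNorm (g n - G) q μ) atTop (𝓝 0)) :
    Tendsto (fun n => eLpNorm ((fun x => K * (|f n x| + |g n x|)) -
      fun x => K * (|F x| + |G x|)) q μ) atTop (𝓝 0) := by
  have h0 : Tendsto (fun n => ‖K‖ₑ * (eLpNorm (f n - F) q μ + eLpNorm (g n - G) q μ)) atTop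
      (𝓝 0) := by
    have := ENNReal.Tendsto.const_mul (a := ‖K‖ₑ) (hf.add hg) (Or.inr enorm_ne_top)
    simpa using this
  refine tendsto_of_tendsto_of_tendsto_of_le_of_le tendsto_const_nhds h0
    (fun _ => zero_le) fun n => ?_
  calc _ ≤ eLpNorm (K • ((fun x => ‖(f n - F) x‖) + fun x => ‖(g n - G) x‖)) q μ := by
        refine eLpNorm_mono fun x => ?_
        simp only [Pi.sub_apply, Pi.smul_apply, Pi.add_apply, smul_eq_mul, norm_mul,
          Real.norm_eq_abs]
        rw [← mul_sub, abs_mul]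
        rw [abs_of_nonneg (by positivity : 0 ≤ |f n x - F x| + |g n x - G x|)]
        refine mul_le_mul_of_nonneg_left ?_ (abs_nonneg K)
        have h1 := abs_abs_sub_abs_le_abs_sub (f n x) (F x)
        have h2 := abs_abs_sub_abs_le_abs_sub (g n x) (G x)
        calc _ = |(|f n x| - |F x|) + (|g n x| - |G x|)| := by ring_nf
          _ ≤ _ := (abs_add_le _ _).trans (add_le_add h1 h2)
    _ ≤ _ := by
        rw [eLpNorm_const_smul]
        gcongr
        refine (eLpNorm_add_le (hfm n).norm (hgm n).norm hq).trans ?_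
        rw [eLpNorm_norm, eLpNorm_norm]

/-- `W_0^{s,p}` is stable under composition with Lipschitz functions of two variables vanishing at
the origin. -/
theorem MemW0.comp_lipschitz (hN : 1 ≤ N) (hs0 : 0 < s) (hs1 : s < 1) (hp : 1 < p)
    {K : NNReal} {F : ℝ × ℝ → ℝ} (hF : LipschitzWith K F) (hF0 : F 0 = 0)
    (hu : MemW0 s p Ω u) (hv : MemW0 s p Ω v) : MemW0 s p Ω fun x => F (u x, v x) := by
  have hp0 : 0 < p := by linarith
  have hq1 : 1 ≤ ENNReal.ofReal p := by simpa using ENNReal.ofReal_le_ofReal hp.le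
  have hm : AEStronglyMeasurable (fun x => F (u x, v x)) volume :=
    hF.continuous.comp_aestronglyMeasurable (hu.aestronglyMeasurable.prodMk hv.aestronglyMeasurable)
  obtain ⟨α, hα, hα1, hα2, hα3⟩ := hu.exists_seq hp
  obtain ⟨β, hβ, hβ1, hβ2, hβ3⟩ := hv.exists_seq hp
  -- `F` need not be smooth, so `F (α n, β n)` need not be a test function. The smooth `H n` vanish
  -- at `0` and share the constant `K`, so `K (|α n| + |β n|)` dominates, and likewise for the
  -- quotients.
  have happ := fun n : ℕ => exists_smooth_lipschitz_approx hF hF0 (ε := 1 / ((n : ℝ) + 1))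
    (by positivity)
  choose H hH hHL hH0 hHF using happ
  have hlim : ∀ᵐ x, Tendsto (fun n => H n (α n x, β n x)) atTop (𝓝 (F (u x, v x))) := by
    filter_upwards [hα3, hβ3] with x hx hy
    have h1 : Tendsto (fun n => F (α n x, β n x)) atTop (𝓝 (F (u x, v x))) :=
      (hF.continuous.tendsto _).comp (hx.prodMk_nhds hy)
    have h2 : Tendsto (fun n => H n (α n x, β n x) - F (α n x, β n x)) atTop (𝓝 0) :=
      squeeze_zero_norm (fun n => hHF n _) tendsto_one_div_add_atTop_nhds_zero_nat
    simpa using h2.add h1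
  have hlim' : ∀ᵐ z : E N × E N ∂((volume : Measure (E N)).prod volume),
      Tendsto (fun n => hquot s p (fun x => H n (α n x, β n x)) z) atTop
        (𝓝 (hquot s p (fun x => F (u x, v x)) z)) := by
    filter_upwards [Measure.quasiMeasurePreserving_fst.ae hlim,
      Measure.quasiMeasurePreserving_snd.ae hlim] with z h1 h2
    exact (h1.sub h2).div_const _
  have hT : ∀ n, IsTestFunction Ω fun x => H n (α n x, β n x) := fun n =>
    (hα n).comp (hH n) (hH0 n) (hβ n)
  have hzero : ∀ {G : ℝ × ℝ → ℝ}, LipschitzWith K G → G 0 = 0 → ∀ a b,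
      |G (a, b)| ≤ K * (|a| + |b|) := fun {G} hG hG0 a b => by
    have := abs_sub_le_of_lipschitzWith hG a b 0 0
    rwa [show ((0 : ℝ), (0 : ℝ)) = 0 from rfl, hG0, sub_zero, sub_zero, sub_zero] at this
  have hpos : ∀ a b : ℝ, (K : ℝ) * (|a| + |b|) = |K * (|a| + |b|)| := fun a b =>
    (abs_of_nonneg (by positivity)).symm
  have hmq := aestronglyMeasurable_hquot (s := s) (p := p) hm
  have h1 : Tendsto (fun n => eLpNorm ((fun x => H n (α n x, β n x)) - fun x => F (u x, v x))
      (ENNReal.ofReal p) volume) atTop (𝓝 0) := by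
    refine tendsto_eLpNorm_of_dominated hq1 (by simp)
      (fun n => (hT n).contDiff.continuous.aestronglyMeasurable)
      ((memLp_majorant K (hu.memLp hp) (hv.memLp hp)).mono' hm
        (.of_forall fun x => hzero hF hF0 _ _))
      (fun n => memLp_majorant K ((hα n).memLp _) ((hβ n).memLp _))
      (memLp_majorant K (hu.memLp hp) (hv.memLp hp))
      (fun n x => (hzero (hHL n) (hH0 n) _ _).trans_eq (hpos _ _)) hlim ?_
    exact tendsto_eLpNorm_majorant hq1 K
      (fun n => (hα n).contDiff.continuous.aestronglyMeasurable.sub hu.aestronglyMeasurable)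
      (fun n => (hβ n).contDiff.continuous.aestronglyMeasurable.sub hv.aestronglyMeasurable)
      hα1 hβ1
  have h2 : Tendsto (fun n => eLpNorm (hquot s p (fun x => H n (α n x, β n x)) -
      hquot s p fun x => F (u x, v x)) (ENNReal.ofReal p) ((volume : Measure (E N)).prod volume))
      atTop (𝓝 0) := by
    have hu' := hu.memLp_hquot hN hs0 hs1 hp
    have hv' := hv.memLp_hquot hN hs0 hs1 hp
    have hα' := fun n => (hα n).memLp_hquot hN hs0 hs1 hp
    have hβ' := fun n => (hβ n).memLp_hquot hN hs0 hs1 hp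
    refine tendsto_eLpNorm_of_dominated hq1 (by simp)
      (fun n => aestronglyMeasurable_hquot (hT n).contDiff.continuous.aestronglyMeasurable)
      ((memLp_majorant K hu' hv').mono' hmq (.of_forall fun z => abs_hquot_comp_le hF u v z))
      (fun n => memLp_majorant K (hα' n) (hβ' n)) (memLp_majorant K hu' hv')
      (fun n z => (abs_hquot_comp_le (hHL n) _ _ z).trans_eq (hpos _ _)) hlim' ?_
    exact tendsto_eLpNorm_majorant hq1 K (fun n => (hα' n).1.sub hu'.1)
      (fun n => (hβ' n).1.sub hv'.1) hα2 hβ2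
  refine ⟨hm, fun ε hε => ?_⟩
  have h3 := h2.add h1
  rw [add_zero] at h3
  obtain ⟨n, hn⟩ := (h3.eventually_lt_const hε).exists
  refine ⟨_, hT n, ?_⟩
  rw [sobolevNorm_eq hp0, hquot_sub, eLpNorm_sub_comm]
  refine lt_of_eq_of_lt ?_ hn
  congr 1
  exact eLpNorm_sub_comm _ _ _ _

/-! ### The comparison principle -/

lemma abs_rpow_mul_self_of_nonneg (hp : 1 < p) {t : ℝ} (ht : 0 ≤ t) :
    |t| ^ (p - 2) * t = t ^ (p - 1) := by
  rw [abs_of_nonneg ht]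
  rcases ht.eq_or_lt with rfl | h
  · simp [Real.zero_rpow (by linarith : p - 1 ≠ 0)]
  · rw [← Real.rpow_add_one h.ne']; ring_nf

lemma strictMono_abs_rpow_mul_self (hp : 1 < p) :
    StrictMono fun t : ℝ => |t| ^ (p - 2) * t := by
  refine strictMono_of_odd_strictMonoOn_nonneg (fun t => by simp) ?_
  intro a ha b hb hab
  simp only [abs_rpow_mul_self_of_nonneg hp ha, abs_rpow_mul_self_of_nonneg hp hb]
  exact Real.rpow_lt_rpow ha hab (by linarith)

/-- The increment of `u - v` fixes the sign of the first factor strictly and of the increment of `(u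
- v)⁺` weakly. Hence the product is nonnegative, and it can vanish only if the increment of `(u -
v)⁺` does. -/
lemma pairingIntegrand_comparison (hp : 1 < p) (u v : E N → ℝ) (z : E N × E N) :
    0 ≤ pairingIntegrand s p u (fun x => max (u x - v x) 0) z -
        pairingIntegrand s p v (fun x => max (u x - v x) 0) z ∧
      (pairingIntegrand s p u (fun x => max (u x - v x) 0) z -
        pairingIntegrand s p v (fun x => max (u x - v x) 0) z = 0 →
          max (u z.1 - v z.1) 0 = max (u z.2 - v z.2) 0) := by
  set w : E N → ℝ := fun x => max (u x - v x) 0 with hw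
  rcases eq_or_ne z.1 z.2 with hz | hz
  · simp [pairingIntegrand, hquot, hz]
  have hr : (0 : ℝ) < ‖z.1 - z.2‖ ^ (((N : ℝ) + s * p) / p) := by
    have : 0 < ‖z.1 - z.2‖ := norm_pos_iff.2 (sub_ne_zero.2 hz)
    positivity
  have hmono := strictMono_abs_rpow_mul_self hp
  have heq : pairingIntegrand s p u w z - pairingIntegrand s p v w z =
      (|hquot s p u z| ^ (p - 2) * hquot s p u z - |hquot s p v z| ^ (p - 2) * hquot s p v z) *
        hquot s p w z := by
    simp only [pairingIntegrand]; ring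
  have hdiff : hquot s p u z - hquot s p v z =
      ((u z.1 - v z.1) - (u z.2 - v z.2)) / ‖z.1 - z.2‖ ^ (((N : ℝ) + s * p) / p) := by
    simp only [hquot]; ring
  have hwz : hquot s p w z = (w z.1 - w z.2) / ‖z.1 - z.2‖ ^ (((N : ℝ) + s * p) / p) := rfl
  have hw0 : hquot s p w z = 0 → w z.1 = w z.2 := fun h => by
    rw [hwz, div_eq_zero_iff] at h
    exact sub_eq_zero.1 (h.resolve_right hr.ne')
  rw [heq]
  rcases lt_trichotomy (u z.1 - v z.1) (u z.2 - v z.2) with h | h | h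
  · have h1 : hquot s p u z < hquot s p v z := by
      rw [← sub_neg, hdiff]; exact div_neg_of_neg_of_pos (by linarith) hr
    have h2 := sub_neg.2 (hmono h1)
    have h3 : hquot s p w z ≤ 0 := by
      rw [hwz]
      exact div_nonpos_of_nonpos_of_nonneg (sub_nonpos.2 (max_le_max_right 0 h.le)) hr.le
    exact ⟨mul_nonneg_of_nonpos_of_nonpos h2.le h3,
      fun h0 => hw0 ((mul_eq_zero.1 h0).resolve_left h2.ne)⟩
  · have h1 : w z.1 = w z.2 := by simp only [hw, h]
    exact ⟨by simp [hwz, h1], fun _ => h1⟩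
  · have h1 : hquot s p v z < hquot s p u z := by
      rw [← sub_pos, hdiff]; exact div_pos (by linarith) hr
    have h2 := sub_pos.2 (hmono h1)
    have h3 : 0 ≤ hquot s p w z := by
      rw [hwz]
      exact div_nonneg (sub_nonneg.2 (max_le_max_right 0 h.le)) hr.le
    exact ⟨mul_nonneg h2.le h3, fun h0 => hw0 ((mul_eq_zero.1 h0).resolve_left h2.ne')⟩

/-- By Fubini `w` is a.e. constant, and a nonzero constant is not in `L^q` of a space of infinite
measure. -/
lemma ae_eq_zero_of_ae_prod_eq (hN : 1 ≤ N) {q : ENNReal} (hq0 : q ≠ 0) (hq : q ≠ ⊤)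
    (hw : MemLp w q volume)
    (h : ∀ᵐ z : E N × E N ∂((volume : Measure (E N)).prod volume), w z.1 = w z.2) :
    w =ᵐ[volume] 0 := by
  have : Nonempty (Fin N) := ⟨⟨0, hN⟩⟩
  have : NoncompactSpace (E N) := NormedSpace.noncompactSpace ℝ (E N)
  obtain ⟨x, hx⟩ := (Measure.ae_ae_of_ae_prod h).exists
  have hconst : w =ᵐ[volume] fun _ => w x := hx.mono fun y hy => hy.symm
  have h2 := (memLp_congr_ae hconst).1 hw
  rw [memLp_const_iff hq0 hq, measure_univ_of_isAddLeftInvariant] at h2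
  have h3 : w x = 0 := by simpa using h2
  rw [h3] at hconst
  exact hconst

lemma MemW0.posPart_sub (hN : 1 ≤ N) (hs0 : 0 < s) (hs1 : s < 1) (hp : 1 < p)
    (hu : MemW0 s p Ω u) (hv : MemW0 s p Ω v) : MemW0 s p Ω fun x => max (u x - v x) 0 := by
  refine MemW0.comp_lipschitz (F := fun a => max (a.1 - a.2) 0) hN hs0 hs1 hp
    (LipschitzWith.max_const (LipschitzWith.prod_fst.sub LipschitzWith.prod_snd) 0) (by simp) hu hv

lemma MemW0.const_mul (hN : 1 ≤ N) (hs0 : 0 < s) (hs1 : s < 1) (hp : 1 < p)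
    (hu : MemW0 s p Ω u) (c : ℝ) : MemW0 s p Ω fun x => c * u x := by
  refine MemW0.comp_lipschitz (F := fun a => c * a.1) (K := ‖c‖₊) hN hs0 hs1 hp
    (LipschitzWith.of_dist_le_mul fun a b => ?_) (by simp) hu hu
  rw [Real.dist_eq, ← mul_sub, abs_mul, Prod.dist_eq]
  simp only [coe_nnnorm, Real.norm_eq_abs]
  gcongr
  exact le_max_left _ _

theorem ae_le_of_fracPairing_le (hN : 1 ≤ N) (hs0 : 0 < s) (hs1 : s < 1) (hp : 1 < p)
    (hu : MemW0 s p Ω u) (hv : MemW0 s p Ω v)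
    (h : fracPairing s p u (fun x => max (u x - v x) 0) ≤
      fracPairing s p v (fun x => max (u x - v x) 0)) : ∀ᵐ x, u x ≤ v x := by
  have hp0 : 0 < p := by linarith
  have hw := hu.posPart_sub hN hs0 hs1 hp hv
  have hw' := hw.memLp_hquot hN hs0 hs1 hp
  have h1 := integrable_pairingIntegrand hp (hu.memLp_hquot hN hs0 hs1 hp) hw'
  have h2 := integrable_pairingIntegrand hp (hv.memLp_hquot hN hs0 hs1 hp) hw'
  rw [fracPairing_eq hp0, fracPairing_eq hp0, ← sub_nonpos, ← integral_sub h1 h2] at h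
  have h3 := h.antisymm (integral_nonneg fun z => (pairingIntegrand_comparison hp u v z).1)
  rw [integral_eq_zero_iff_of_nonneg (fun z => (pairingIntegrand_comparison hp u v z).1)
    (h1.sub h2)] at h3
  have h4 := ae_eq_zero_of_ae_prod_eq hN (by simpa using hp0) (by simp) (hw.memLp hp)
    (h3.mono fun z hz => (pairingIntegrand_comparison hp u v z).2 hz)
  filter_upwards [h4] with x hx
  have : max (u x - v x) 0 = 0 := hx
  linarith [max_eq_right_iff.1 this]

/-! ### Picone's inequality -/

lemma mul_div_rpow_self {c x : ℝ} (hc : 0 < c) (hx : 0 ≤ x) :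
    c * (x / c) ^ p = x ^ p / c ^ (p - 1) := by
  rw [Real.div_rpow hx hc.le, Real.rpow_sub_one hc.ne']
  have : 0 < c ^ p := by positivity
  field_simp

/-- Convexity of `t^p` with weights `(a - b)/a` and `b/a` gives `A^p ≤ (|A - B| + B)^p ≤ (a/(a -
b))^(p-1) |A - B|^p + (a/b)^(p-1) B^p`; multiply by `((a - b)/a)^(p-1)`. -/
lemma picone_of_lt (hp : 1 < p) {a b A B : ℝ} (hb : 0 < b) (hab : b < a) (hA : 0 ≤ A)
    (hB : 0 ≤ B) :
    |a - b| ^ (p - 2) * (a - b) * (A ^ p / a ^ (p - 1) - B ^ p / b ^ (p - 1)) ≤ |A - B| ^ p := by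
  have ha : 0 < a := hb.trans hab
  have hd : 0 < a - b := sub_pos.2 hab
  rw [abs_rpow_mul_self_of_nonneg hp hd.le]
  have hconv := (convexOn_rpow hp.le).2 (x := |A - B| / ((a - b) / a)) (y := B / (b / a))
    (Set.mem_Ici.2 (by positivity)) (Set.mem_Ici.2 (by positivity))
    (by positivity : 0 ≤ (a - b) / a) (by positivity : 0 ≤ b / a) (by field_simp; ring)
  simp only [smul_eq_mul] at hconv
  rw [mul_div_rpow_self (by positivity) (abs_nonneg _), mul_div_rpow_self (by positivity) hB,
    mul_div_cancel₀ _ (by positivity), mul_div_cancel₀ _ (by positivity)] at hconv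
  have hle : A ^ p ≤ (|A - B| + B) ^ p := by
    gcongr
    linarith [le_abs_self (A - B)]
  have h := hle.trans hconv
  rw [Real.div_rpow hd.le ha.le, Real.div_rpow hb.le ha.le] at h
  have h1 : 0 < a ^ (p - 1) := by positivity
  have h2 : 0 < b ^ (p - 1) := by positivity
  have h3 : 0 < (a - b) ^ (p - 1) := by positivity
  calc (a - b) ^ (p - 1) * (A ^ p / a ^ (p - 1) - B ^ p / b ^ (p - 1))
      ≤ (a - b) ^ (p - 1) * ((|A - B| ^ p / ((a - b) ^ (p - 1) / a ^ (p - 1)) +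
          B ^ p / (b ^ (p - 1) / a ^ (p - 1))) / a ^ (p - 1) - B ^ p / b ^ (p - 1)) := by gcongr
    _ = |A - B| ^ p := by field_simp; ring

/-- Discrete Picone inequality. -/
lemma picone (hp : 1 < p) {a b A B : ℝ} (ha : 0 < a) (hb : 0 < b) (hA : 0 ≤ A) (hB : 0 ≤ B) :
    |a - b| ^ (p - 2) * (a - b) * (A ^ p / a ^ (p - 1) - B ^ p / b ^ (p - 1)) ≤ |A - B| ^ p := by
  rcases lt_trichotomy a b with h | rfl | h
  · have := picone_of_lt hp ha h hB hA
    rw [abs_sub_comm b a, abs_sub_comm B A] at this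
    linarith
  · simp; positivity
  · exact picone_of_lt hp hb h hA hB

/-- The function `min(|a|, k)^p / (b⁺ + ε)^{p-1}` used to build test functions. -/
def piconeFun (p k ε : ℝ) (z : ℝ × ℝ) : ℝ :=
  min |z.1| k ^ p / (max z.2 0 + ε) ^ (p - 1)

lemma piconeFun_nonneg {k ε : ℝ} (hk : 0 ≤ k) (hε : 0 < ε) (z : ℝ × ℝ) :
    0 ≤ piconeFun p k ε z := by
  have h1 : 0 ≤ min |z.1| k := le_min (abs_nonneg _) hk
  have h2 : 0 ≤ max z.2 0 := le_max_right _ _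
  unfold piconeFun
  positivity

lemma abs_min_abs_sub_le (a b k : ℝ) : |min |a| k - min |b| k| ≤ |a - b| :=
  (abs_min_sub_min_le_max _ _ _ _).trans (by simpa using abs_abs_sub_abs_le_abs_sub a b)

lemma exists_lipschitz_min_rpow (hp : 1 < p) {k : ℝ} (hk : 0 ≤ k) :
    ∃ C : ℝ, 0 ≤ C ∧ ∀ a b : ℝ, |min |a| k ^ p - min |b| k ^ p| ≤ C * |a - b| := by
  have hc : ContDiff ℝ 1 fun x : ℝ => x ^ p :=
    Real.contDiff_rpow_const_of_le (n := 1) (by simpa using hp.le)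
  obtain ⟨C, hC⟩ := hc.contDiffOn.exists_lipschitzOnWith one_ne_zero (convex_Icc 0 k) isCompact_Icc
  refine ⟨C, C.2, fun a b => ?_⟩
  have := hC.dist_le_mul (min |a| k) ⟨le_min (abs_nonneg _) hk, min_le_right _ _⟩
    (min |b| k) ⟨le_min (abs_nonneg _) hk, min_le_right _ _⟩
  rw [Real.dist_eq, Real.dist_eq] at this
  exact this.trans (mul_le_mul_of_nonneg_left (abs_min_abs_sub_le a b k) C.2)

lemma exists_lipschitz_inv_rpow (hp : 1 < p) {ε : ℝ} (hε : 0 < ε) :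
    ∃ C : ℝ, 0 ≤ C ∧ ∀ a b : ℝ,
      |((max a 0 + ε) ^ (p - 1))⁻¹ - ((max b 0 + ε) ^ (p - 1))⁻¹| ≤ C * |a - b| := by
  -- The supremum of `|d/dx x^(1-p)|` on `[ε, ∞)`.
  refine ⟨(p - 1) * ε ^ (-p), by have := sub_pos.2 hp; positivity, fun a b => ?_⟩
  have hd : ∀ x ∈ Set.Ici ε, HasDerivWithinAt (fun x : ℝ => x ^ (1 - p))
      ((1 - p) * x ^ (1 - p - 1)) (Set.Ici ε) x := fun x hx =>
    (Real.hasDerivAt_rpow_const (Or.inl (hε.trans_le hx).ne')).hasDerivWithinAt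
  have hb : ∀ x ∈ Set.Ici ε, ‖(1 - p) * x ^ (1 - p - 1)‖ ≤ (p - 1) * ε ^ (-p) := fun x hx => by
    have hx0 : 0 < x := hε.trans_le hx
    rw [norm_mul, Real.norm_of_nonneg (by positivity : 0 ≤ x ^ (1 - p - 1)), Real.norm_eq_abs,
      abs_sub_comm, abs_of_pos (sub_pos.2 hp), show 1 - p - 1 = -p by ring]
    have := sub_pos.2 hp
    gcongr ?_ * ?_
    exact Real.rpow_le_rpow_of_nonpos hε hx (by linarith)
  have hmem : ∀ t : ℝ, max t 0 + ε ∈ Set.Ici ε := fun t =>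
    Set.mem_Ici.2 (by linarith [le_max_right t 0])
  have h := (convex_Ici ε).norm_image_sub_le_of_norm_hasDerivWithin_le hd hb (hmem b) (hmem a)
  have hpos : ∀ t : ℝ, 0 ≤ max t 0 + ε := fun t => hε.le.trans (hmem t)
  rw [show 1 - p = -(p - 1) by ring, Real.rpow_neg (hpos a), Real.rpow_neg (hpos b),
    Real.norm_eq_abs, Real.norm_eq_abs] at h
  refine h.trans (mul_le_mul_of_nonneg_left ?_ (by have := sub_pos.2 hp; positivity))
  rw [add_sub_add_right_eq_sub]
  exact (abs_max_sub_max_le_max _ _ _ _).trans (by simp)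

/-- A product of bounded Lipschitz functions: truncation at `k` controls the numerator, and `ε`
keeps the denominator away from zero. -/
lemma exists_lipschitzWith_piconeFun (hp : 1 < p) {k ε : ℝ} (hk : 0 ≤ k) (hε : 0 < ε) :
    ∃ K : NNReal, LipschitzWith K (piconeFun p k ε) := by
  obtain ⟨C, hC, h1⟩ := exists_lipschitz_min_rpow hp hk
  obtain ⟨D, hD, h2⟩ := exists_lipschitz_inv_rpow hp hε
  have hf : ∀ a : ℝ, |min |a| k ^ p| ≤ k ^ p := fun a => by
    have h0 : 0 ≤ min |a| k := le_min (abs_nonneg _) hk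
    rw [abs_of_nonneg (by positivity)]
    gcongr
    exact min_le_right _ _
  have hg : ∀ b : ℝ, |((max b 0 + ε) ^ (p - 1))⁻¹| ≤ (ε ^ (p - 1))⁻¹ := fun b => by
    have h0 : 0 ≤ max b 0 := le_max_right _ _
    have := sub_pos.2 hp
    rw [abs_of_nonneg (by positivity)]
    gcongr
    linarith
  refine ⟨NNReal.mk (C * (ε ^ (p - 1))⁻¹ + k ^ p * D) (by positivity),
    LipschitzWith.of_dist_le_mul fun x y => ?_⟩
  rw [Real.dist_eq, NNReal.coe_mk]
  have hx1 : |x.1 - y.1| ≤ dist x y := le_max_left (dist x.1 y.1) (dist x.2 y.2)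
  have hx2 : |x.2 - y.2| ≤ dist x y := le_max_right (dist x.1 y.1) (dist x.2 y.2)
  simp only [piconeFun, div_eq_mul_inv]
  calc _ = |(min |x.1| k ^ p - min |y.1| k ^ p) * ((max x.2 0 + ε) ^ (p - 1))⁻¹ +
          min |y.1| k ^ p * (((max x.2 0 + ε) ^ (p - 1))⁻¹ - ((max y.2 0 + ε) ^ (p - 1))⁻¹)| := by
        ring_nf
    _ ≤ (C * dist x y) * (ε ^ (p - 1))⁻¹ + k ^ p * (D * dist x y) := by
        refine (abs_add_le _ _).trans ?_
        rw [abs_mul, abs_mul]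
        refine add_le_add (mul_le_mul ((h1 _ _).trans ?_) (hg _) (abs_nonneg _) (by positivity))
          (mul_le_mul (hf _) ((h2 _ _).trans ?_) (abs_nonneg _) (by positivity)) <;> gcongr
    _ = _ := by ring

lemma MemW0.piconeFun (hN : 1 ≤ N) (hs0 : 0 < s) (hs1 : s < 1) (hp : 1 < p)
    (hu : MemW0 s p Ω u) (hv : MemW0 s p Ω v) {k ε : ℝ} (hk : 0 ≤ k) (hε : 0 < ε) :
    MemW0 s p Ω fun x => FracTorsion.piconeFun p k ε (u x, v x) := by
  obtain ⟨K, hK⟩ := exists_lipschitzWith_piconeFun hp hk hε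
  refine hu.comp_lipschitz hN hs0 hs1 hp hK ?_ hv
  simp [FracTorsion.piconeFun, hk, Real.zero_rpow (by linarith : p ≠ 0)]

/-- Picone is applied to `v + ε`, which has the same increments as `v`; truncating `|u|` at `k` only
shrinks increments. -/
lemma pairingIntegrand_piconeFun_le (hp : 1 < p) {k ε : ℝ} (hk : 0 ≤ k) (hε : 0 < ε)
    (u v : E N → ℝ) {z : E N × E N} (h1 : 0 ≤ v z.1) (h2 : 0 ≤ v z.2) :
    pairingIntegrand s p v (fun x => piconeFun p k ε (u x, v x)) z ≤ |hquot s p u z| ^ p := by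
  have hp0 : 0 < p := by linarith
  rw [pairingIntegrand_eq hp0, abs_hquot_rpow hp0]
  gcongr
  have := picone hp (a := v z.1 + ε) (b := v z.2 + ε) (A := min |u z.1| k) (B := min |u z.2| k)
    (by positivity) (by positivity) (le_min (abs_nonneg _) hk) (le_min (abs_nonneg _) hk)
  rw [add_sub_add_right_eq_sub] at this
  simp only [piconeFun, max_eq_left h1, max_eq_left h2]
  exact this.trans (Real.rpow_le_rpow (abs_nonneg _) (abs_min_abs_sub_le _ _ _) hp0.le)

/-! ### Integral forms of the energy and homogeneity of the pairing -/

lemma MemW0.integrableOn (hp : 1 < p) (hΩ : volume Ω < ⊤) (hu : MemW0 s p Ω u) :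
    IntegrableOn u Ω := by
  have : IsFiniteMeasure (volume.restrict Ω) := ⟨by simpa using hΩ⟩
  exact ((hu.memLp hp).restrict Ω).integrable (by simpa using ENNReal.ofReal_le_ofReal hp.le)

lemma gagliardoPow_eq_ofReal_integral (hp : 0 < p)
    (hu : MemLp (hquot s p u) (ENNReal.ofReal p) ((volume : Measure (E N)).prod volume)) :
    gagliardoPow s p u =
      ENNReal.ofReal (∫ z, |hquot s p u z| ^ p ∂((volume : Measure (E N)).prod volume)) := by
  rw [gagliardoPow_eq_lintegral hp, ofReal_integral_eq_lintegral_ofReal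
    (integrable_abs_rpow hp hu) (.of_forall fun z => by positivity)]

lemma eLpNorm_rpow_eq_lintegral {α : Type*} [MeasurableSpace α] {μ : Measure α} (hp : 0 < p)
    (f : α → ℝ) :
    eLpNorm f (ENNReal.ofReal p) μ ^ p = ∫⁻ x, ENNReal.ofReal (|f x| ^ p) ∂μ := by
  rw [eLpNorm_eq_lintegral_rpow_enorm_toReal (by simpa using hp) (by simp),
    ENNReal.toReal_ofReal hp.le, ← ENNReal.rpow_mul, one_div_mul_cancel hp.ne', ENNReal.rpow_one]
  refine lintegral_congr fun x => ?_
  rw [← Real.norm_eq_abs, ← ofReal_norm, ENNReal.ofReal_rpow_of_nonneg (norm_nonneg _) hp.le]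

lemma fracPairing_zero_left (v : E N → ℝ) : fracPairing s p (fun _ => 0) v = 0 := by
  simp [fracPairing]

lemma fracPairing_const_mul_left (hp : 1 < p) {c : ℝ} (hc : 0 ≤ c) (u v : E N → ℝ) :
    fracPairing s p (fun x => c * u x) v = c ^ (p - 1) * fracPairing s p u v := by
  rw [fracPairing, fracPairing, ← integral_const_mul]
  congr 1
  ext z
  rw [← mul_sub, abs_mul, Real.mul_rpow (abs_nonneg _) (abs_nonneg _),
    ← abs_rpow_mul_self_of_nonneg hp hc]
  ring

lemma fracPairing_self (hp : 1 < p) (u : E N → ℝ) :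
    fracPairing s p u u = ∫ z, |hquot s p u z| ^ p ∂((volume : Measure (E N)).prod volume) := by
  rw [fracPairing_eq (by linarith)]
  congr 1
  ext z
  rw [pairingIntegrand, mul_assoc, ← abs_mul_abs_self, ← mul_assoc]
  nth_rewrite 1 [← abs_abs (hquot s p u z)]
  rw [abs_rpow_mul_self_of_nonneg hp (abs_nonneg _),
    ← Real.rpow_add_one' (abs_nonneg _) (by linarith)]
  ring_nf

/-! ### The torsion function -/

lemma MemW0.zero (hp : 0 < p) : MemW0 s p Ω fun _ => 0 :=
  IsTestFunction.memW0 ⟨contDiff_const, HasCompactSupport.zero, by simp [tsupport]⟩ hp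

namespace IsTorsionFunction

lemma fracPairing_eq_integral (hφ : IsTorsionFunction s p Ω φ) (hv : MemW0 s p Ω v) :
    fracPairing s p φ v = ∫ x in Ω, v x := by
  simpa using hφ.weak v hv

lemma nonneg (hN : 1 ≤ N) (hs0 : 0 < s) (hs1 : s < 1) (hp : 1 < p)
    (hφ : IsTorsionFunction s p Ω φ) : ∀ᵐ x, 0 ≤ φ x := by
  have h0 : MemW0 s p Ω fun _ => 0 := MemW0.zero (by linarith)
  refine ae_le_of_fracPairing_le (u := fun _ => 0) hN hs0 hs1 hp h0 hφ.memW0 ?_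
  rw [fracPairing_zero_left, hφ.fracPairing_eq_integral (h0.posPart_sub hN hs0 hs1 hp hφ.memW0)]
  exact integral_nonneg fun x => le_max_right _ _

/-- Picone's inequality for the torsion function, in truncated form. -/
theorem lintegral_piconeFun_le (hN : 1 ≤ N) (hs0 : 0 < s) (hs1 : s < 1) (hp : 1 < p)
    (hΩ : volume Ω < ⊤) (hφ : IsTorsionFunction s p Ω φ) (hu : MemW0 s p Ω u) {k ε : ℝ}
    (hk : 0 ≤ k) (hε : 0 < ε) :
    ∫⁻ x in Ω, ENNReal.ofReal (piconeFun p k ε (u x, φ x)) ≤ gagliardoPow s p u := by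
  have hp0 : 0 < p := by linarith
  have hw := hu.piconeFun hN hs0 hs1 hp hφ.memW0 hk hε
  have hu' := hu.memLp_hquot hN hs0 hs1 hp
  have hφ0 := hφ.nonneg hN hs0 hs1 hp
  rw [← ofReal_integral_eq_lintegral_ofReal (hw.integrableOn hp hΩ)
    (.of_forall fun x => piconeFun_nonneg hk hε _), ← hφ.fracPairing_eq_integral hw,
    gagliardoPow_eq_ofReal_integral hp0 hu', fracPairing_eq hp0]
  refine ENNReal.ofReal_le_ofReal (integral_mono_ae
    (integrable_pairingIntegrand hp (hφ.memW0.memLp_hquot hN hs0 hs1 hp)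
      (hw.memLp_hquot hN hs0 hs1 hp)) (integrable_abs_rpow hp0 hu') ?_)
  filter_upwards [Measure.quasiMeasurePreserving_fst.ae hφ0,
    Measure.quasiMeasurePreserving_snd.ae hφ0] with z h1 h2
  exact pairingIntegrand_piconeFun_le hp hk hε u φ h1 h2

/-- On `{φ ≤ 0}` the Picone quotient is `|ψ|^p / ε^(p-1)`, while its integral stays below the finite
energy of `ψ`; let `ε → 0`. -/
lemma ae_testFunction_eq_zero_of_nonpos (hN : 1 ≤ N) (hs0 : 0 < s) (hs1 : s < 1) (hp : 1 < p)
    (hΩ : volume Ω < ⊤) (hφ : IsTorsionFunction s p Ω φ) (hψ : IsTestFunction Ω ψ) :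
    ∀ᵐ x ∂(volume.restrict Ω), φ x ≤ 0 → ψ x = 0 := by
  have hp0 : 0 < p := by linarith
  -- With `k` a bound for `|ψ|`, the truncation is inactive.
  obtain ⟨-, k, -, hk, hψk, -⟩ := hψ.exists_bound
  have hfin := hψ.gagliardoPow_lt_top hN hs0 hs1 hp
  set G := gagliardoPow s p ψ
  have hφm : AEMeasurable φ (volume.restrict Ω) :=
    hφ.memW0.aestronglyMeasurable.aemeasurable.restrict
  let f : E N → ENNReal := {x | φ x ≤ 0}.indicator fun x => ENNReal.ofReal (|ψ x| ^ p)
  have hs : NullMeasurableSet {x | φ x ≤ 0} (volume.restrict Ω) :=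
    nullMeasurableSet_le hφm aemeasurable_const
  have hfm : AEMeasurable f (volume.restrict Ω) := by
    refine AEMeasurable.indicator₀ ?_ hs
    have := hψ.contDiff.continuous.measurable
    fun_prop
  have hbound : ∀ ε : ℝ, 0 < ε → ∫⁻ x in Ω, f x ≤ ENNReal.ofReal (ε ^ (p - 1)) * G := by
    intro ε hε
    refine le_trans ?_ (mul_le_mul_right (hφ.lintegral_piconeFun_le hN hs0 hs1 hp hΩ
      (hψ.memW0 hp0) hk hε) _)
    rw [← lintegral_const_mul' _ _ ENNReal.ofReal_ne_top]
    refine lintegral_mono fun x => ?_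
    by_cases hx : φ x ≤ 0
    · have hx' : x ∈ {x | φ x ≤ 0} := hx
      simp only [f, Set.indicator_of_mem hx', piconeFun, min_eq_left (hψk x), max_eq_right hx,
        zero_add]
      rw [← ENNReal.ofReal_mul (by positivity), mul_div_cancel₀ _ (by positivity)]
    · have hx' : x ∉ {x | φ x ≤ 0} := hx
      simp [f, Set.indicator_of_notMem hx']
  have hlim : Tendsto (fun ε : ℝ => ENNReal.ofReal (ε ^ (p - 1)) * G) (𝓝[>] 0) (𝓝 0) := by
    have h1 : Tendsto (fun ε : ℝ => ε ^ (p - 1)) (𝓝[>] 0) (𝓝 0) := by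
      have : ContinuousAt (fun ε : ℝ => ε ^ (p - 1)) 0 :=
        Real.continuousAt_rpow_const _ _ (Or.inr (by linarith))
      have h := this.tendsto
      rw [Real.zero_rpow (by linarith : p - 1 ≠ 0)] at h
      exact h.mono_left nhdsWithin_le_nhds
    have h2 := ENNReal.Tendsto.mul_const (b := G) (ENNReal.tendsto_ofReal h1) (Or.inr hfin.ne)
    simpa using h2
  have hzero : ∫⁻ x in Ω, f x = 0 :=
    le_antisymm (ge_of_tendsto hlim (eventually_mem_nhdsWithin.mono fun ε hε => hbound ε hε))
      zero_le
  rw [lintegral_eq_zero_iff' hfm] at hzero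
  filter_upwards [hzero] with x hx hx0
  have hx' : x ∈ {x | φ x ≤ 0} := hx0
  simp only [f, Set.indicator_of_mem hx', Pi.zero_apply, ENNReal.ofReal_eq_zero] at hx
  by_contra h
  have : 0 < |ψ x| ^ p := by have := abs_pos.2 h; positivity
  linarith

/-- Near each point of `Ω` some test function is nonzero, so `{φ ≤ 0} ∩ Ω` is locally null. -/
theorem pos (hN : 1 ≤ N) (hs0 : 0 < s) (hs1 : s < 1) (hp : 1 < p)
    (hΩo : IsOpen Ω) (hΩ : volume Ω < ⊤) (hφ : IsTorsionFunction s p Ω φ) :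
    ∀ᵐ x ∂(volume.restrict Ω), 0 < φ x := by
  rw [ae_restrict_iff' hΩo.measurableSet, ae_iff]
  refine measure_null_of_locally_null _ fun x hx => ?_
  have hxΩ : x ∈ Ω := by
    by_contra h
    exact hx fun h' => absurd h' h
  obtain ⟨ψ, hψ1, hψ2, hψ3, -, hψ4⟩ := exists_contDiff_tsupport_subset (n := ⊤)
    (hΩo.mem_nhds hxΩ)
  have hψ : IsTestFunction Ω ψ := ⟨hψ3, hψ2, hψ1⟩
  have hne : {y | ψ y ≠ 0} ∈ 𝓝 x :=
    (isOpen_ne_fun hψ3.continuous continuous_const).mem_nhds (by simp [hψ4])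
  refine ⟨_, inter_mem_nhdsWithin _ hne, ?_⟩
  have h := hφ.ae_testFunction_eq_zero_of_nonpos hN hs0 hs1 hp hΩ hψ
  rw [ae_restrict_iff' hΩo.measurableSet, ae_iff] at h
  refine measure_mono_null ?_ h
  rintro y ⟨hy1, hy2⟩ hy
  simp only [Set.mem_ofPred_eq, Classical.not_imp, not_lt] at hy1
  exact hy2 (hy hy1.1 hy1.2)

/-! ### Bounds for the first eigenvalue and its eigenfunction -/

/-- Picone is applied to every competitor `u`, so the infimum need not be attained. -/
theorem one_div_le_firstEigenvalue (hN : 1 ≤ N) (hs0 : 0 < s) (hs1 : s < 1) (hp : 1 < p)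
    (hΩ : volume Ω < ⊤) (hφ : IsTorsionFunction s p Ω φ) :
    1 / eLpNorm φ ⊤ (volume.restrict Ω) ^ (p - 1) ≤ firstEigenvalue s p Ω := by
  have hp0 : 0 < p := by linarith
  have hp1 : 0 < p - 1 := by linarith
  refine le_sInf ?_
  rintro _ ⟨u, hu, hu1, rfl⟩
  set m := eLpNorm φ ⊤ (volume.restrict Ω) with hm
  rcases eq_or_ne m ⊤ with h | hmt
  · simp [h, ENNReal.top_rpow_of_pos hp1]
  have hfin : gagliardoPow s p u ≠ ⊤ := by
    rw [gagliardoPow_eq_ofReal_integral hp0 (hu.memLp_hquot hN hs0 hs1 hp)]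
    exact ENNReal.ofReal_ne_top
  have hle : ∀ᵐ x ∂(volume.restrict Ω), max (φ x) 0 ≤ m.toReal := by
    have h1 : ∀ᵐ x ∂(volume.restrict Ω), ‖φ x‖ₑ ≤ m := by
      rw [hm, eLpNorm_exponent_top]; exact enorm_ae_le_eLpNormEssSup _ _
    filter_upwards [h1] with x hx
    refine max_le ?_ ENNReal.toReal_nonneg
    have := ENNReal.toReal_mono hmt hx
    rw [toReal_enorm] at this
    exact (Real.le_norm_self _).trans this
  refine ENNReal.div_le_of_le_mul ?_
  have hone : ∫⁻ x in Ω, ENNReal.ofReal (|u x| ^ p) = 1 := by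
    rw [← eLpNorm_rpow_eq_lintegral hp0, hu1, ENNReal.one_rpow]
  have hum : AEMeasurable u (volume.restrict Ω) :=
    hu.aestronglyMeasurable.aemeasurable.restrict
  have hmin : ∀ (x : E N) (n : ℕ), 0 ≤ min |u x| n := fun x n => le_min (abs_nonneg _) n.cast_nonneg
  have hleft : Tendsto (fun n : ℕ => ∫⁻ x in Ω, ENNReal.ofReal (min |u x| n ^ p)) atTop (𝓝 1) := by
    rw [← hone]
    refine lintegral_tendsto_of_tendsto_of_monotone (fun n => ?_) (.of_forall fun x => ?_)
      (.of_forall fun x => ?_)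
    · fun_prop
    · intro i j hij
      have := hmin x i
      have : (i : ℝ) ≤ j := by exact_mod_cast hij
      dsimp only
      gcongr
    · refine tendsto_const_nhds.congr' ?_
      obtain ⟨n, hn⟩ := exists_nat_ge |u x|
      filter_upwards [eventually_ge_atTop n] with i hi
      rw [min_eq_left (hn.trans (by exact_mod_cast hi))]
  -- Truncation and regularisation are removed together: `k = n`, `ε = 1/(n+1)`.
  have hright : Tendsto (fun n : ℕ => gagliardoPow s p u *
      ENNReal.ofReal ((m.toReal + 1 / ((n : ℝ) + 1)) ^ (p - 1))) atTop
      (𝓝 (gagliardoPow s p u * m ^ (p - 1))) := by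
    have hm' : m ^ (p - 1) = ENNReal.ofReal ((m.toReal + 0) ^ (p - 1)) := by
      rw [add_zero, ← ENNReal.ofReal_rpow_of_nonneg ENNReal.toReal_nonneg hp1.le,
        ENNReal.ofReal_toReal hmt]
    rw [hm']
    refine ENNReal.Tendsto.const_mul (ENNReal.tendsto_ofReal ?_) (Or.inr hfin)
    exact (tendsto_one_div_add_atTop_nhds_zero_nat.const_add _).rpow_const (Or.inr hp1.le)
  refine le_of_tendsto_of_tendsto' hleft hright fun n => ?_
  have hn : (0 : ℝ) < 1 / ((n : ℝ) + 1) := by positivity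
  refine le_trans ?_ (mul_le_mul_left (hφ.lintegral_piconeFun_le hN hs0 hs1 hp hΩ hu
      (k := n) (Nat.cast_nonneg n) hn) _)
  rw [← lintegral_mul_const' _ _ ENNReal.ofReal_ne_top]
  refine lintegral_mono_ae ?_
  filter_upwards [hle] with x hx
  have h0 : 0 ≤ max (φ x) 0 := le_max_right _ _
  rw [← ENNReal.ofReal_mul (piconeFun_nonneg n.cast_nonneg hn _)]
  refine ENNReal.ofReal_le_ofReal ?_
  have h1 : 0 < (max (φ x) 0 + 1 / ((n : ℝ) + 1)) ^ (p - 1) := by positivity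
  have h2 := hmin x n
  calc min |u x| n ^ p = min |u x| n ^ p / (max (φ x) 0 + 1 / ((n : ℝ) + 1)) ^ (p - 1) *
        (max (φ x) 0 + 1 / ((n : ℝ) + 1)) ^ (p - 1) := by field_simp
    _ ≤ _ := by
      simp only [piconeFun]
      gcongr

/-- The competitor is `φ / |φ|_p`. Positivity of `φ` makes the norms nonzero and identifies `∫ φ`
with `|φ|_1`. -/
theorem firstEigenvalue_le (hN : 1 ≤ N) (hs0 : 0 < s) (hs1 : s < 1) (hp : 1 < p)
    (hΩo : IsOpen Ω) (hΩne : Ω.Nonempty) (hΩ : volume Ω < ⊤) (hφ : IsTorsionFunction s p Ω φ) :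
    firstEigenvalue s p Ω ≤
      volume Ω ^ (p - 1) / eLpNorm φ 1 (volume.restrict Ω) ^ (p - 1) := by
  have hp0 : 0 < p := by linarith
  have hp1 : 0 < p - 1 := by linarith
  have hpos := hφ.pos hN hs0 hs1 hp hΩo hΩ
  have hΩ0 : volume.restrict Ω ≠ 0 := by
    simpa [Measure.restrict_eq_zero] using (hΩo.measure_pos volume hΩne).ne'
  have hint := hφ.memW0.integrableOn hp hΩ
  have hmem := (hφ.memW0.memLp hp).restrict Ω
  set n₁ := eLpNorm φ 1 (volume.restrict Ω)
  set m := eLpNorm φ (ENNReal.ofReal p) (volume.restrict Ω)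
  have hne : ∀ {q : ENNReal}, q ≠ 0 → eLpNorm φ q (volume.restrict Ω) ≠ 0 := fun hq h => by
    rw [eLpNorm_eq_zero_iff hmem.1 hq] at h
    have : NeBot (ae (volume.restrict Ω)) := ae_neBot.2 hΩ0
    obtain ⟨x, hx1, hx2⟩ := (hpos.and h).exists
    exact hx1.ne' hx2
  have hn0 : n₁ ≠ 0 := hne one_ne_zero
  have hm0 : m ≠ 0 := hne (by simpa using hp0)
  have hnt : n₁ ≠ ⊤ := (memLp_one_iff_integrable.2 hint).2.ne
  have hmt : m ≠ ⊤ := hmem.2.ne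
  have henergy : gagliardoPow s p φ = n₁ := by
    rw [gagliardoPow_eq_ofReal_integral hp0 (hφ.memW0.memLp_hquot hN hs0 hs1 hp),
      ← fracPairing_self hp, hφ.fracPairing_eq_integral hφ.memW0,
      ofReal_integral_eq_lintegral_ofReal hint (hpos.mono fun x hx => hx.le)]
    simp only [n₁, eLpNorm_one_eq_lintegral_enorm]
    refine lintegral_congr_ae (hpos.mono fun x hx => ?_)
    simp only [← ofReal_norm, Real.norm_of_nonneg (le_of_lt hx)]
  have hmem' : MemW0 s p Ω fun x => m.toReal⁻¹ * φ x :=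
    hφ.memW0.const_mul hN hs0 hs1 hp _
  have hc : ‖m.toReal⁻¹‖ₑ = m⁻¹ := by
    rw [enorm_inv (ENNReal.toReal_ne_zero.2 ⟨hm0, hmt⟩), ← ofReal_norm,
      Real.norm_of_nonneg ENNReal.toReal_nonneg, ENNReal.ofReal_toReal hmt]
  have hnorm : eLpNorm (fun x => m.toReal⁻¹ * φ x) (ENNReal.ofReal p) (volume.restrict Ω) = 1 := by
    have := eLpNorm_const_smul m.toReal⁻¹ φ (ENNReal.ofReal p) (volume.restrict Ω)
    rw [hc] at this
    exact this.trans (ENNReal.inv_mul_cancel hm0 hmt)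
  have hgag : gagliardoPow s p (fun x => m.toReal⁻¹ * φ x) = n₁ / m ^ p := by
    have := eLpNorm_const_smul m.toReal⁻¹ (hquot s p φ) (ENNReal.ofReal p)
      ((volume : Measure (E N)).prod volume)
    rw [gagliardoPow_eq_gagliardo_rpow hp0, gagliardo_eq_eLpNorm hp0, hquot_const_mul]
    refine (congrArg (· ^ p) this).trans ?_
    rw [hc, ENNReal.mul_rpow_of_nonneg _ _ hp0.le, ← gagliardo_eq_eLpNorm hp0,
      ← gagliardoPow_eq_gagliardo_rpow hp0, henergy, ENNReal.inv_rpow, mul_comm,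
      ENNReal.div_eq_inv_mul, mul_comm]
  have hholder : n₁ ^ p ≤ m ^ p * volume Ω ^ (p - 1) := by
    have h := eLpNorm_le_eLpNorm_mul_rpow_measure_univ (p := 1) (q := ENNReal.ofReal p)
      (by simpa using ENNReal.ofReal_le_ofReal hp.le) hmem.1
    have h' := ENNReal.rpow_le_rpow h hp0.le
    rw [ENNReal.mul_rpow_of_nonneg _ _ hp0.le, ← ENNReal.rpow_mul, Measure.restrict_apply_univ,
      ENNReal.toReal_ofReal hp0.le, ENNReal.toReal_one,
      show (1 / 1 - 1 / p) * p = p - 1 by field_simp] at h'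
    exact h'
  have hinf : firstEigenvalue s p Ω ≤ n₁ / m ^ p := hgag ▸ sInf_le ⟨_, hmem', hnorm, rfl⟩
  refine hinf.trans ?_
  -- After clearing denominators, what remains is Hölder's `n₁^p ≤ m^p |Ω|^(p-1)`.
  have hn1 : n₁ ^ (p - 1) ≠ 0 := (ENNReal.rpow_pos (pos_iff_ne_zero.2 hn0) hnt).ne'
  have hn1t : n₁ ^ (p - 1) ≠ ⊤ := ENNReal.rpow_ne_top_of_nonneg hp1.le hnt
  have hsplit : n₁ * n₁ ^ (p - 1) = n₁ ^ p := by
    nth_rewrite 1 [← ENNReal.rpow_one n₁]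
    rw [← ENNReal.rpow_add _ _ hn0 hnt, add_sub_cancel]
  rw [ENNReal.le_div_iff_mul_le (Or.inl hn1) (Or.inl hn1t), div_eq_mul_inv, mul_right_comm, hsplit,
    ← div_eq_mul_inv]
  exact ENNReal.div_le_of_le_mul' hholder

theorem eigenfunction_le (hN : 1 ≤ N) (hs0 : 0 < s) (hs1 : s < 1) (hp : 1 < p)
    (hΩ : volume Ω < ⊤) (hφ : IsTorsionFunction s p Ω φ)
    (he : IsNormalizedFirstEigenfunction s p Ω e) :
    ∀ᵐ x, e x ≤ (firstEigenvalue s p Ω).toReal ^ (1 / (p - 1)) * φ x := by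
  have hp1 : 0 < p - 1 := by linarith
  -- The equation and the claim carry the same real number `l`, of which only `0 ≤ l` matters.
  set l := (firstEigenvalue s p Ω).toReal
  have hl : 0 ≤ l := ENNReal.toReal_nonneg
  have he0 := he.isWeakSolution.memW0
  have hcφ : MemW0 s p Ω fun x => l ^ (1 / (p - 1)) * φ x := hφ.memW0.const_mul hN hs0 hs1 hp _
  have hw := he0.posPart_sub hN hs0 hs1 hp hcφ
  refine ae_le_of_fracPairing_le hN hs0 hs1 hp he0 hcφ ?_
  rw [fracPairing_const_mul_left hp (by positivity), ← Real.rpow_mul hl,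
    one_div_mul_cancel hp1.ne', Real.rpow_one, hφ.fracPairing_eq_integral hw,
    he.isWeakSolution.weak _ hw, ← integral_const_mul]
  have h1 : ∀ᵐ x ∂(volume.restrict Ω), e x ≤ 1 := by
    have h2 : ∀ᵐ x ∂(volume.restrict Ω), ‖e x‖ₑ ≤ 1 := by
      have := he.norm_eq_one
      rw [eLpNorm_exponent_top] at this
      rw [← this]
      exact enorm_ae_le_eLpNormEssSup _ _
    filter_upwards [h2] with x hx
    have := ENNReal.toReal_mono ENNReal.one_ne_top hx
    rw [toReal_enorm, ENNReal.toReal_one] at this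
    exact (Real.le_norm_self _).trans this
  refine integral_mono_of_nonneg ?_ ((hw.integrableOn hp hΩ).const_mul l) ?_
  · filter_upwards [he.pos] with x hx
    have : 0 ≤ max (e x - l ^ (1 / (p - 1)) * φ x) 0 := le_max_right _ _
    simp only [Pi.zero_apply]
    positivity
  · filter_upwards [he.pos, h1] with x hx hx1
    have : 0 ≤ max (e x - l ^ (1 / (p - 1)) * φ x) 0 := le_max_right _ _
    gcongr
    exact mul_le_of_le_one_right hl (Real.rpow_le_one hx.le hx1 hp1.le)

end IsTorsionFunction

end FracTorsion

end

theorem mainTheorem5 (N : ℕ) (hN : 2 ≤ N) (s p : ℝ) (hs0 : 0 < s) (hs1 : s < 1)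
    (hp1 : 1 < p) (hpN : p < (N : ℝ) / s)
    (Ω : Set (FracTorsion.E N)) (hΩ : FracTorsion.IsBoundedLipschitzDomain Ω)
    (φ : FracTorsion.E N → ℝ) (hφ : FracTorsion.IsTorsionFunction s p Ω φ) :
    (∀ e : FracTorsion.E N → ℝ, FracTorsion.IsNormalizedFirstEigenfunction s p Ω e →
      ∀ᵐ x ∂(volume.restrict Ω),
        e x ≤ (FracTorsion.firstEigenvalue s p Ω).toReal ^ (1 / (p - 1)) * φ x) ∧
    1 / eLpNorm φ ⊤ (volume.restrict Ω) ^ (p - 1) ≤ FracTorsion.firstEigenvalue s p Ω ∧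
    FracTorsion.firstEigenvalue s p Ω ≤
      volume Ω ^ (p - 1) / eLpNorm φ 1 (volume.restrict Ω) ^ (p - 1) ∧
    ∀ᵐ x ∂(volume.restrict Ω), 0 < φ x := by
  have hN1 : 1 ≤ N := by omega
  have hfin : volume Ω < ⊤ := hΩ.isBounded.measure_lt_top
  exact ⟨fun e he => ae_restrict_of_ae (hφ.eigenfunction_le hN1 hs0 hs1 hp1 hfin he),
    hφ.one_div_le_firstEigenvalue hN1 hs0 hs1 hp1 hfin,
    hφ.firstEigenvalue_le hN1 hs0 hs1 hp1 hΩ.isOpen hΩ.isConnected.nonempty hfin,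
    hφ.pos hN1 hs0 hs1 hp1 hΩ.isOpen hfin⟩
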